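/- Let $s\ge 0$ and consider an explicit $s$-stage two-step Runge--Kutta method for $u'=F(u)$, $$y_i^n = d_i u^{n-1} + (1-d_i)u^n + h\sum_{j=1}^s \hat a_{ij}F(y_j^{n-1}) + h\sum_{j=1}^{s} a_{ij}F(y_j^n)\quad(1\le i\le s),$$ $$u^{n+1} = \theta u^{n-1} + (1-\theta)u^n + h\sum_{j=1}^s \hat b_{j}F(y_j^{n-1}) + h\sum_{j=1}^s b_jF(y_j^n),$$ with real coefficients and $a_{ij}=0$ for $j\ge i$. The stage values $y_j^{n-1}$ left from the previous step are inputs of the step, subject only to $y_j^{n-1}=u^{n-1}$ if stage $j$ is $y_j^n=u^n$ (i.e. $d_j=0$ and row $j$ of $A$ and of $\hat A$ vanishes) and to $y_i^{n-1}=y_j^{n-1}$ if stages $i$ and $j$ have the same coefficients; such inputs are called admissible. The method is strong stability preserving (SSP) if there is $C>0$ such that for every $F:\mathbb R^N\to\mathbb R^N$, every convex functional $\varphi$ on $\mathbb R^N$ and every $\Delta t_{FE}>0$ with $\varphi(v+\tau F(v))\le\varphi(v)$ for all $v$ and all $0\le\tau\le\Delta t_{FE}$, each step of size $0<h\le C\,\Delta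 t_{FE}$ from admissible inputs satisfies $\varphi(u^{n+1})\le\max\{\varphi(u^n),\varphi(u^{n-1}),\max_j\varphi(y_j^{n-1})\}$. (If the method uses $y^{n-1}$ not at all, or only through $F(u^{n-1})$, this is $\varphi(u^{n+1})\le\max\{\varphi(u^n),\varphi(u^{n-1})\}$.) The method has order at least $p$ if for every smooth $F:\mathbb R^N\to\mathbb R^N$ and every solution $u$ of $u'=F(u)$ near $0$ there are stage values $Y(h,t)=u(t)+O(h)$ such that the step with $u^{n-1}=u(t-h)$, $u^n=u(t)$, $y^{n-1}=Y(h,t-h)$ gives $y^n=Y(h,t)+O(h^p)$ and $u^{n+1}=u(t+h)+O(h^{p+1})$ as $h\to0^+$, uniformly for $t$ near $0$. Two sets of coefficients represent the same method if they always give the same $u^{n+1}$ from the same $u^{n-1},u^n$ and admissible inputs. A representation is of Type I form if $\hat A=0$ and $\hat b=0$; it is of Type II form if one of its stages, say the $j$-th, is $y_j^n=u^n$ and $\hat A$, $\hat b$ vanish outside column (entry) $j$, so that of the previous step only $F(y_j^{n-1})=F(u^{n-1})$ is used. An explicit $s$-stage method is of Type II if for some $k\le s$ it has an explicit $k$-stage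 representation of Type II form but no explicit representation of Type I form with at most $k$ stages. Theorem. If an explicit SSP two-step Runge--Kutta method has order at least $p$, then $p\le 8$. If moreover $p>6$, then the method is of Type II, and $u^{n-1}$ is one of the points at which it evaluates $F$: either some stage $y_i^n$ is identically equal to $u^{n-1}$, or for some stage with $y_j^n=u^n$ the value $F(y_j^{n-1})=F(u^{n-1})$ occurs with a nonzero coefficient $\hat b_j$ or $\hat a_{ij}$. -/

import Mathlib

/-- Coefficients of an `s`-stage two-step Runge-Kutta method
`y_i^n = d_i u^{n-1} + (1 - d_i) u^n + h ∑ â_{ij} F(y_j^{n-1}) + h ∑ a_{ij} F(y_j^n)`,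
`u^{n+1} = θ u^{n-1} + (1 - θ) u^n + h ∑ b̂_j F(y_j^{n-1}) + h ∑ b_j F(y_j^n)`. -/
structure TSRK (s : ℕ) where
  d : Fin s → ℝ
  θ : ℝ
  A : Matrix (Fin s) (Fin s) ℝ
  Ahat : Matrix (Fin s) (Fin s) ℝ
  b : Fin s → ℝ
  bhat : Fin s → ℝ

namespace TSRK

/-- The method is explicit: stage `i` uses, of the current step, only the stages before it. -/
def IsExplicit {s : ℕ} (M : TSRK s) : Prop :=
  ∀ i j : Fin s, i ≤ j → M.A i j = 0

/-- One step of size `h` for `u' = F(u)`: from the inputs `uprev = u^{n-1}`, `ucur = u^n`,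
`yprev = y^{n-1}` it produces the stages `y = y^n` and the new value `unext = u^{n+1}`.
For an explicit method `y` and `unext` exist and are unique. -/
def IsStep {s : ℕ} (M : TSRK s) {N : ℕ} (F : (Fin N → ℝ) → (Fin N → ℝ)) (h : ℝ)
    (uprev ucur : Fin N → ℝ) (yprev y : Fin s → Fin N → ℝ) (unext : Fin N → ℝ) : Prop :=
  (∀ i, y i = M.d i • uprev + (1 - M.d i) • ucur
      + h • ∑ j, M.Ahat i j • F (yprev j) + h • ∑ j, M.A i j • F (y j)) ∧
  unext = M.θ • uprev + (1 - M.θ) • ucur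
      + h • ∑ j, M.bhat j • F (yprev j) + h • ∑ j, M.b j • F (y j)

/-- Stage `i` is the one with `y_i^n = u^n`. -/
def IsCurrentStage {s : ℕ} (M : TSRK s) (i : Fin s) : Prop :=
  M.d i = 0 ∧ (∀ j, M.A i j = 0) ∧ (∀ j, M.Ahat i j = 0)

/-- Stages `i` and `j` are given by the same formula. -/
def SameStage {s : ℕ} (M : TSRK s) (i j : Fin s) : Prop :=
  M.d i = M.d j ∧ (∀ k, M.A i k = M.A j k) ∧ (∀ k, M.Ahat i k = M.Ahat j k)

/-- Input stage values `y^{n-1}` that respect the identities between the stages of the method: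
a stage with `y_i^n = u^n` has `y_i^{n-1} = u^{n-1}`, and identically equal stages agree.
All other stage values of the previous step are free inputs. -/
def AdmissibleInput {s : ℕ} (M : TSRK s) {N : ℕ} (uprev : Fin N → ℝ)
    (yprev : Fin s → Fin N → ℝ) : Prop :=
  (∀ i, M.IsCurrentStage i → yprev i = uprev) ∧
  (∀ i j, M.SameStage i j → yprev i = yprev j)

/-- `C` is an admissible step-size coefficient: whenever the forward Euler method is strongly
stable for the convex functional `φ` with step sizes up to `ΔtFE`, the value `u^{n+1}` satisfies
`φ(u^{n+1}) ≤ max (inputs of the step)` for all step sizes `h ≤ C ΔtFE`. -/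
def MonotoneWith {s : ℕ} (M : TSRK s) (C : ℝ) : Prop :=
  ∀ (N : ℕ) (φ : (Fin N → ℝ) → ℝ) (F : (Fin N → ℝ) → (Fin N → ℝ)) (ΔtFE : ℝ),
    ConvexOn ℝ Set.univ φ → 0 < ΔtFE →
    (∀ (v : Fin N → ℝ) (τ : ℝ), 0 ≤ τ → τ ≤ ΔtFE → φ (v + τ • F v) ≤ φ v) →
    ∀ h : ℝ, 0 < h → h ≤ C * ΔtFE →
    ∀ (uprev ucur : Fin N → ℝ) (yprev y : Fin s → Fin N → ℝ) (unext : Fin N → ℝ),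
      M.AdmissibleInput uprev yprev → M.IsStep F h uprev ucur yprev y unext →
      ∀ R : ℝ, φ uprev ≤ R → φ ucur ≤ R → (∀ j, φ (yprev j) ≤ R) → φ unext ≤ R

/-- Strong stability preserving: the SSP coefficient (the largest `C` as above) is positive. -/
def IsSSP {s : ℕ} (M : TSRK s) : Prop :=
  ∃ C : ℝ, 0 < C ∧ M.MonotoneWith C

/-- The (explicit) method is of order at least `p`: for every smooth system `u' = F(u)` and every
solution `u` there are stage values `Y h t`, consistent with `u t`, such that one step from exact
solution values and from the previous stage values `Y h (t - h)` reproduces the stage values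
`Y h t` up to `O(h^p)` and the solution `u (t + h)` up to `O(h^(p+1))`, locally uniformly in `t`.
If the method does not use `y^{n-1}`, or only uses `F(u^{n-1})`, this says that its
local error is `O(h^(p+1))`. -/
def HasOrder {s : ℕ} (M : TSRK s) (p : ℕ) : Prop :=
  ∀ (N : ℕ) (F : (Fin N → ℝ) → (Fin N → ℝ)) (u : ℝ → Fin N → ℝ) (a : ℝ),
    ContDiff ℝ ((⊤ : ℕ∞) : WithTop ℕ∞) F → 0 < a →
    (∀ t ∈ Set.Ioo (-a) a, HasDerivAt u (F (u t)) t) →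
    ∃ (Y : ℝ → ℝ → Fin s → Fin N → ℝ) (ε K : ℝ), 0 < ε ∧
      (∀ h ∈ Set.Ioo 0 ε, ∀ t ∈ Set.Ioo (-ε) ε, ∀ i, ‖Y h t i - u t‖ ≤ K * h) ∧
      ∀ h ∈ Set.Ioo 0 ε, ∀ t ∈ Set.Ioo (-ε) ε,
        ∀ (y : Fin s → Fin N → ℝ) (unext : Fin N → ℝ),
          M.IsStep F h (u (t - h)) (u t) (Y h (t - h)) y unext →
            (∀ i, ‖y i - Y h t i‖ ≤ K * h ^ p) ∧ ‖unext - u (t + h)‖ ≤ K * h ^ (p + 1)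

/-- The Type I form: no stage of the previous step is used. -/
def HasTypeIForm {s : ℕ} (M : TSRK s) : Prop :=
  (∀ i j, M.Ahat i j = 0) ∧ (∀ j, M.bhat j = 0)

/-- The Type II form: one stage is `u^n` and, of the previous step, only `F(u^{n-1})`
(the value of `F` at that stage) is used. -/
def HasTypeIIForm {s : ℕ} (M : TSRK s) : Prop :=
  ∃ j, M.IsCurrentStage j ∧ (∀ i k, k ≠ j → M.Ahat i k = 0) ∧ (∀ k, k ≠ j → M.bhat k = 0)

/-- Two sets of coefficients represent the same method: they always produce the same `u^{n+1}`. -/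
def Equivalent {s s' : ℕ} (M : TSRK s) (M' : TSRK s') : Prop :=
  ∀ (N : ℕ) (F : (Fin N → ℝ) → (Fin N → ℝ)) (h : ℝ), 0 < h →
    ∀ (uprev ucur : Fin N → ℝ) (yprev y : Fin s → Fin N → ℝ) (yprev' y' : Fin s' → Fin N → ℝ)
      (unext unext' : Fin N → ℝ),
      M.AdmissibleInput uprev yprev → M'.AdmissibleInput uprev yprev' →
      M.IsStep F h uprev ucur yprev y unext → M'.IsStep F h uprev ucur yprev' y' unext' →
      unext = unext'

/-- An explicit method is of Type II (rather than of Type I): it has, without additional stages,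
an explicit Type II representation, and every explicit Type I representation of it needs more
stages than that one. -/
def IsOfTypeII {s : ℕ} (M : TSRK s) : Prop :=
  ∃ k : ℕ, k ≤ s ∧
    (∃ M' : TSRK k, M'.IsExplicit ∧ M'.HasTypeIIForm ∧ M.Equivalent M') ∧
    ∀ k' : ℕ, k' ≤ k → ∀ M' : TSRK k', M'.IsExplicit → M'.HasTypeIForm → ¬ M.Equivalent M'

/-- One of the points at which the method evaluates `F` is `u^{n-1}`: either a stage `y_i^n` that is
identically equal to `u^{n-1}`, or the stage value `y_j^{n-1} = u^{n-1}` left from the previous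
step by a stage `y_j^n = u^n`, where that value is used with a nonzero coefficient. -/
def HasStageEqPrev {s : ℕ} (M : TSRK s) : Prop :=
  (∃ i, ∀ (N : ℕ) (F : (Fin N → ℝ) → (Fin N → ℝ)) (h : ℝ), 0 < h →
    ∀ (uprev ucur : Fin N → ℝ) (yprev y : Fin s → Fin N → ℝ) (unext : Fin N → ℝ),
      M.AdmissibleInput uprev yprev → M.IsStep F h uprev ucur yprev y unext → y i = uprev) ∨
  (∃ j, M.IsCurrentStage j ∧ (M.bhat j ≠ 0 ∨ ∃ i, M.Ahat i j ≠ 0))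

end TSRK

namespace TSRK

/-! ### Steps of a method and their evaluation points -/

variable {s : ℕ} {V W : Type*} [AddCommGroup V] [Module ℝ V] [AddCommGroup W] [Module ℝ W]

/-! The vector field in the SSP property is arbitrary, even discontinuous, so it can respond to one
evaluation point alone. Points that coincide in every step must be lumped together; the meaningful
weights are the class sums `classSum`. Testing with the maximum of two extra components shows three
things: output weights are nonnegative (`IsSSP.classSum_outWeight_nonneg`); inputs other than
`u^{n-1}` have output weight zero (`IsSSP.classSum_outWeight_inl`); a stage with positive output
weight draws only on points with positive output weight (`IsSSP.classSum_weight_eq_zero`). So the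
output depends only on `u^n`, `u^{n-1}`, `F (u^{n-1})` and the reduced stages.

Order conditions then become rigid (`HasOrder.moment_conditions`): a test problem whose last
component integrates the squared stage defect gives a sum of squares with positive weights that must
vanish. Hence order `2k + 1` makes every reduced stage exact for `t^k`.

The first reduced stage that is not `u^n` is built from `u^{n-1}`, `u^n` and the slopes there. Order
7 makes it exact on cubics, hence the cubic Hermite interpolant at some `c ≠ 0, -1`; both slopes
occur with nonzero weights. Order 9 would require exactness for `t^4`, but the error is `(c(c+1))^2
≠ 0` (`HasOrder.first_nontrivial`). Both slopes being needed also gives Type II: a Type I form must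
spend a separate stage on `u^{n-1}` (`card_reducedStages_lt`). -/

/-- The weights of stage `i`: `inl j` stands for `F (y_j^{n-1})`, `inr j` for `F (y_j^n)`. -/
def weight (M : TSRK s) (i : Fin s) : Fin s ⊕ Fin s → ℝ := Sum.elim (M.Ahat i) (M.A i)

/-- The weights of the new value. -/
def outWeight (M : TSRK s) : Fin s ⊕ Fin s → ℝ := Sum.elim M.bhat M.b

/-- A step from admissible inputs, with all evaluation points collected in `P`:
`none` stands for `u^{n-1}`, `inl j` for `y_j^{n-1}` and `inr j` for `y_j^n`. -/
structure Run (M : TSRK s) (F : V → V) (h : ℝ) (ucur : V) (P : Option (Fin s ⊕ Fin s) → V)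
    (unext : V) : Prop where
  current : ∀ j, M.IsCurrentStage j → P (some (.inl j)) = P none
  same : ∀ i j, M.SameStage i j → P (some (.inl i)) = P (some (.inl j))
  stage : ∀ i, P (some (.inr i)) = M.d i • P none + (1 - M.d i) • ucur
    + h • ∑ e, M.weight i e • F (P (some e))
  next : unext = M.θ • P none + (1 - M.θ) • ucur + h • ∑ e, M.outWeight e • F (P (some e))

/-- The evaluation points of a step. -/
def points {V : Type*} (uprev : V) (yprev y : Fin s → V) : Option (Fin s ⊕ Fin s) → V
  | none => uprev
  | some (.inl j) => yprev j
  | some (.inr j) => y j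

theorem isStep_iff (M : TSRK s) {N : ℕ} {F : (Fin N → ℝ) → (Fin N → ℝ)} {h : ℝ}
    {uprev ucur unext : Fin N → ℝ} {yprev y : Fin s → Fin N → ℝ} :
    M.IsStep F h uprev ucur yprev y unext ↔
      (∀ i, y i = M.d i • uprev + (1 - M.d i) • ucur
        + h • ∑ e, M.weight i e • F (points uprev yprev y (some e))) ∧
      unext = M.θ • uprev + (1 - M.θ) • ucur
        + h • ∑ e, M.outWeight e • F (points uprev yprev y (some e)) := by
  simp [IsStep, points, weight, outWeight, Fintype.sum_sum_type, smul_add, add_assoc]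

theorem run_points_iff (M : TSRK s) {N : ℕ} {F : (Fin N → ℝ) → (Fin N → ℝ)} {h : ℝ}
    {uprev ucur unext : Fin N → ℝ} {yprev y : Fin s → Fin N → ℝ} :
    M.Run F h ucur (points uprev yprev y) unext ↔
      M.AdmissibleInput uprev yprev ∧ M.IsStep F h uprev ucur yprev y unext := by
  rw [isStep_iff]
  exact ⟨fun ⟨h1, h2, h3, h4⟩ => ⟨⟨h1, h2⟩, h3, h4⟩, fun ⟨⟨h1, h2⟩, h3, h4⟩ => ⟨h1, h2, h3, h4⟩⟩

theorem points_eta {V : Type*} (P : Option (Fin s ⊕ Fin s) → V) :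
    points (P none) (fun j => P (some (.inl j))) (fun j => P (some (.inr j))) = P := by
  funext x
  rcases x with _ | j | j <;> rfl

theorem IsExplicit.exists_stages {M : TSRK s} (hM : M.IsExplicit) (F : V → V) (h : ℝ)
    (uprev ucur : V) (yprev : Fin s → V) :
    ∃ y : Fin s → V, ∀ i, y i = M.d i • uprev + (1 - M.d i) • ucur
      + h • ∑ e, M.weight i e • F (points uprev yprev y (some e)) := by
  have key : ∀ n : ℕ, ∃ y : Fin s → V, ∀ i : Fin s, (i : ℕ) < n →
      y i = M.d i • uprev + (1 - M.d i) • ucur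
      + h • ∑ e, M.weight i e • F (points uprev yprev y (some e)) := by
    intro n
    induction n with
    | zero => exact ⟨fun _ => 0, fun i hi => absurd hi (Nat.not_lt_zero _)⟩
    | succ n ih =>
      obtain ⟨y, hy⟩ := ih
      by_cases hn : n < s
      -- Changing entry `n` does not disturb the rows up to `n`, because `A` is strictly lower
      -- triangular.
      · set z : Fin s → V := Function.update y ⟨n, hn⟩ (M.d ⟨n, hn⟩ • uprev
          + (1 - M.d ⟨n, hn⟩) • ucur
          + h • ∑ e, M.weight ⟨n, hn⟩ e • F (points uprev yprev y (some e))) with hz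
        have hsum : ∀ i : Fin s, (i : ℕ) ≤ n →
            ∑ e, M.weight i e • F (points uprev yprev z (some e))
              = ∑ e, M.weight i e • F (points uprev yprev y (some e)) := by
          intro i hi
          refine Finset.sum_congr rfl fun e _ => ?_
          rcases e with j | j
          · rfl
          · by_cases hj : j = ⟨n, hn⟩
            · have : M.weight i (.inr j) = 0 := hM i j (by subst hj; exact hi)
              rw [this, zero_smul, zero_smul]
            · simp [points, hz, Function.update_of_ne hj]
        refine ⟨z, fun i hi => ?_⟩
        rw [hsum i (Nat.lt_succ_iff.mp hi)]
        by_cases hin : i = ⟨n, hn⟩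
        · subst hin; simp [hz]
        · have hlt : (i : ℕ) < n := lt_of_le_of_ne (Nat.lt_succ_iff.mp hi)
            fun hc => hin (Fin.ext hc)
          rw [hz, Function.update_of_ne hin]
          exact hy i hlt
      · exact ⟨y, fun i _ => hy i (by omega)⟩
  obtain ⟨y, hy⟩ := key s
  exact ⟨y, fun i => hy i i.isLt⟩

theorem IsExplicit.exists_run {M : TSRK s} (hM : M.IsExplicit) (F : V → V) (h : ℝ)
    (uprev ucur : V) (yprev : Fin s → V) (h1 : ∀ j, M.IsCurrentStage j → yprev j = uprev)
    (h2 : ∀ i j, M.SameStage i j → yprev i = yprev j) :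
    ∃ P unext, M.Run F h ucur P unext ∧ P none = uprev ∧ ∀ j, P (some (.inl j)) = yprev j := by
  obtain ⟨y, hy⟩ := hM.exists_stages F h uprev ucur yprev
  exact ⟨points uprev yprev y, _, ⟨h1, h2, hy, rfl⟩, rfl, fun _ => rfl⟩

theorem IsExplicit.exists_isStep {M : TSRK s} (hM : M.IsExplicit) {N : ℕ}
    (F : (Fin N → ℝ) → (Fin N → ℝ)) (h : ℝ) (uprev ucur : Fin N → ℝ)
    (yprev : Fin s → Fin N → ℝ) :
    ∃ y unext, M.IsStep F h uprev ucur yprev y unext := by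
  obtain ⟨y, hy⟩ := hM.exists_stages F h uprev ucur yprev
  exact ⟨y, _, M.isStep_iff.mpr ⟨hy, rfl⟩⟩

theorem Run.unique {M : TSRK s} (hM : M.IsExplicit) {F : V → V} {h : ℝ} {ucur : V}
    {P P' : Option (Fin s ⊕ Fin s) → V} {u u' : V} (hP : M.Run F h ucur P u)
    (hP' : M.Run F h ucur P' u') (h0 : P none = P' none)
    (h1 : ∀ j, P (some (.inl j)) = P' (some (.inl j))) : P = P' := by
  have key : ∀ i, P (some (.inr i)) = P' (some (.inr i)) := by
    intro i
    induction i using WellFoundedLT.induction with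
    | ind i ih =>
      rw [hP.stage, hP'.stage, h0]
      congr 2
      refine Finset.sum_congr rfl fun e _ => ?_
      rcases e with j | j
      · rw [h1]
      · rcases lt_or_ge j i with hj | hj
        · rw [ih j hj]
        · have : M.weight i (.inr j) = 0 := hM i j hj
          rw [this, zero_smul, zero_smul]
  funext x
  rcases x with _ | j | j
  exacts [h0, h1 j, key j]

theorem Run.map {M : TSRK s} {F : V → V} {h : ℝ} {ucur : V} {P : Option (Fin s ⊕ Fin s) → V}
    {u : V} (hP : M.Run F h ucur P u) (f : V →ₗ[ℝ] W) {G : W → W}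
    (hG : ∀ v, G (f v) = f (F v)) : M.Run G h (f ucur) (fun x => f (P x)) (f u) := by
  refine ⟨fun j hj => by rw [hP.current j hj], fun i j hij => by rw [hP.same i j hij],
    fun i => ?_, ?_⟩
  · simp only [hP.stage i, hG, map_add, map_smul, map_sum]
  · simp only [hP.next, hG, map_add, map_smul, map_sum]

/-- Only the product of step size and field enters a step. This brings steps of different sizes to a
common one, so that they can run side by side in `Run.pi`. -/
theorem Run.rescale {M : TSRK s} {F : V → V} {h : ℝ} {ucur : V}
    {P : Option (Fin s ⊕ Fin s) → V} {u : V} (hP : M.Run F h ucur P u) {k : ℝ} (hk : k ≠ 0) :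
    M.Run (fun v => (h / k) • F v) k ucur P u := by
  have key : ∀ a : Fin s ⊕ Fin s → ℝ, k • ∑ e, a e • (h / k) • F (P (some e))
      = h • ∑ e, a e • F (P (some e)) := by
    intro a
    simp only [smul_comm _ (h / k), ← Finset.smul_sum]
    rw [smul_smul, div_mul_cancel₀ _ hk]
  refine ⟨hP.current, hP.same, fun i => ?_, ?_⟩
  · rw [key, hP.stage i]
  · rw [key, hP.next]

theorem Run.pi {M : TSRK s} {ι : Type*} {E : ι → Type*} [∀ q, AddCommGroup (E q)]
    [∀ q, Module ℝ (E q)] {F : ∀ q, E q → E q} {h : ℝ} {ucur : ∀ q, E q}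
    {P : ∀ q, Option (Fin s ⊕ Fin s) → E q} {u : ∀ q, E q}
    (hP : ∀ q, M.Run (F q) h (ucur q) (P q) (u q)) :
    M.Run (fun v q => F q (v q)) h ucur (fun x q => P q x) u := by
  refine ⟨fun j hj => funext fun q => (hP q).current j hj,
    fun i j hij => funext fun q => (hP q).same i j hij, fun i => funext fun q => ?_,
    funext fun q => ?_⟩
  · simpa using (hP q).stage i
  · simpa using (hP q).next

/-! ### Classes of coinciding points -/

/-- The points `x` and `x'` coincide in every step from admissible inputs. -/
def SamePoint (M : TSRK s) (x x' : Option (Fin s ⊕ Fin s)) : Prop :=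
  ∀ (N : ℕ) (F : (Fin N → ℝ) → (Fin N → ℝ)) (h : ℝ), 0 < h →
    ∀ (ucur : Fin N → ℝ) (P : Option (Fin s ⊕ Fin s) → Fin N → ℝ) (unext : Fin N → ℝ),
      M.Run F h ucur P unext → P x = P x'

theorem SamePoint.refl {M : TSRK s} (x : Option (Fin s ⊕ Fin s)) : M.SamePoint x x :=
  fun _ _ _ _ _ _ _ _ => rfl

theorem SamePoint.symm {M : TSRK s} {x y : Option (Fin s ⊕ Fin s)} (h : M.SamePoint x y) :
    M.SamePoint y x :=
  fun N F k hk ucur P u hP => (h N F k hk ucur P u hP).symm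

theorem SamePoint.trans {M : TSRK s} {x y z : Option (Fin s ⊕ Fin s)} (h : M.SamePoint x y)
    (h' : M.SamePoint y z) : M.SamePoint x z :=
  fun N F k hk ucur P u hP => (h N F k hk ucur P u hP).trans (h' N F k hk ucur P u hP)

theorem SamePoint.eq [FiniteDimensional ℝ V] {M : TSRK s} {x x' : Option (Fin s ⊕ Fin s)}
    (hx : M.SamePoint x x') {F : V → V} {h : ℝ} (hh : 0 < h) {ucur : V}
    {P : Option (Fin s ⊕ Fin s) → V} {u : V} (hP : M.Run F h ucur P u) : P x = P x' := by
  let e : V ≃ₗ[ℝ] (Fin (Module.finrank ℝ V) → ℝ) := (Module.finBasis ℝ V).equivFun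
  have := hP.map e.toLinearMap (G := fun w => e (F (e.symm w))) (fun v => by simp)
  exact e.injective (hx _ _ h hh _ _ _ this)

/-- The classes of coinciding evaluation points. -/
def samePointSetoid (M : TSRK s) : Setoid (Option (Fin s ⊕ Fin s)) :=
  ⟨M.SamePoint, SamePoint.refl, SamePoint.symm, SamePoint.trans⟩

/-- The sum of the weights `a` over the class of the point `x`. -/
noncomputable def classSum (M : TSRK s) (a : Fin s ⊕ Fin s → ℝ)
    (x : Option (Fin s ⊕ Fin s)) : ℝ :=
  open Classical in ∑ e, if M.SamePoint (some e) x then a e else 0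

theorem classSum_congr {M : TSRK s} (a : Fin s ⊕ Fin s → ℝ) {x x' : Option (Fin s ⊕ Fin s)}
    (h : M.SamePoint x x') : M.classSum a x = M.classSum a x' := by
  classical
  unfold classSum
  refine Finset.sum_congr rfl fun e _ => ?_
  have : M.SamePoint (some e) x ↔ M.SamePoint (some e) x' :=
    ⟨fun hx => hx.trans h, fun hx => hx.trans h.symm⟩
  simp only [this]

theorem exists_mem_of_classSum_ne_zero {M : TSRK s} {a : Fin s ⊕ Fin s → ℝ}
    {x : Option (Fin s ⊕ Fin s)} (h : M.classSum a x ≠ 0) :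
    ∃ e, M.SamePoint (some e) x ∧ a e ≠ 0 := by
  classical
  obtain ⟨e, -, he⟩ := Finset.exists_ne_zero_of_sum_ne_zero h
  by_cases hx : M.SamePoint (some e) x
  · exact ⟨e, hx, by simpa [hx] using he⟩
  · simp [hx] at he

/-- Some step separates all points that do not always coincide. -/
theorem IsExplicit.exists_separating_run {M : TSRK s} (hM : M.IsExplicit) {h : ℝ} (hh : 0 < h) :
    ∃ (N : ℕ) (F : (Fin N → ℝ) → (Fin N → ℝ)) (ucur : Fin N → ℝ)
      (P : Option (Fin s ⊕ Fin s) → Fin N → ℝ) (u : Fin N → ℝ),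
      M.Run F h ucur P u ∧ ∀ x x', P x = P x' → M.SamePoint x x' := by
  -- One separating step per pair of points; there are finitely many pairs, so the product of these
  -- steps is still finite-dimensional.
  have key : ∀ q : Option (Fin s ⊕ Fin s) × Option (Fin s ⊕ Fin s),
      ∃ (N : ℕ) (F : (Fin N → ℝ) → (Fin N → ℝ)) (ucur : Fin N → ℝ)
      (P : Option (Fin s ⊕ Fin s) → Fin N → ℝ) (u : Fin N → ℝ),
      M.Run F h ucur P u ∧ (P q.1 = P q.2 → M.SamePoint q.1 q.2) := by
    rintro ⟨x, x'⟩
    by_cases hx : M.SamePoint x x'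
    · obtain ⟨P, u, hP, -⟩ := hM.exists_run (V := Fin 0 → ℝ) (fun v => v) h 0 0 (fun _ => 0)
        (fun _ _ => rfl) (fun _ _ _ => rfl)
      exact ⟨0, _, _, P, u, hP, fun _ => hx⟩
    · have hx' := hx
      simp only [SamePoint, not_forall] at hx
      obtain ⟨N, F, k, hk, ucur, P, u, hP, hne⟩ := hx
      exact ⟨N, _, ucur, P, u, hP.rescale hh.ne', fun hc => absurd hc hne⟩
  choose N F ucur P u hP hsep using key
  have hrun := Run.pi hP
  let e : (∀ q, Fin (N q) → ℝ) ≃ₗ[ℝ] (Fin (Module.finrank ℝ (∀ q, Fin (N q) → ℝ)) → ℝ) :=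
    (Module.finBasis ℝ _).equivFun
  refine ⟨_, _, _, _, _, hrun.map e.toLinearMap
    (G := fun w => e ((fun v q => F q (v q)) (e.symm w))) (fun v => by simp), ?_⟩
  intro x x' hxx
  exact hsep (x, x') (congrFun (e.injective hxx) (x, x'))

/-- A step can be extended by further components, driven by the points of the step. -/
theorem IsExplicit.exists_extension {M : TSRK s} (hM : M.IsExplicit) {F : V → V} {h : ℝ}
    {ucur u : V} {P : Option (Fin s ⊕ Fin s) → V} (hP : M.Run F h ucur P u) (G : V × W → W)
    (wprev wcur : W) (w : Fin s → W) (h1 : ∀ j, M.IsCurrentStage j → w j = wprev)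
    (h2 : ∀ i j, M.SameStage i j → w i = w j) :
    ∃ (Q : Option (Fin s ⊕ Fin s) → W) (unext : W),
      M.Run (fun v => (F v.1, G v)) h (ucur, wcur) (fun x => (P x, Q x)) (u, unext) ∧
      Q none = wprev ∧ ∀ j, Q (some (.inl j)) = w j := by
  obtain ⟨R, r, hR, h0, hw⟩ := hM.exists_run (V := V × W) (fun v => (F v.1, G v)) h
    (P none, wprev) (ucur, wcur) (fun j => (P (some (.inl j)), w j))
    (fun j hj => by simp only [hP.current j hj, h1 j hj])
    (fun i j hij => by simp only [hP.same i j hij, h2 i j hij])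
  have hfst := hR.map (LinearMap.fst ℝ V W) (G := F) (fun v => rfl)
  -- The added components never act back on the old ones, so uniqueness identifies the old part with
  -- the given step.
  have heq : (fun x => (R x).1) = P :=
    hfst.unique hM hP (by simp [h0]) (fun j => by simp [hw])
  have hr : r.1 = u := by
    rw [hP.next, ← heq]; exact hfst.next
  have hR' : R = fun x => (P x, (R x).2) := by
    funext x; rw [← heq]
  refine ⟨fun x => (R x).2, r.2, ?_, by simp [h0], fun j => by simp [hw]⟩
  rw [← hR', ← hr]
  exact hR

theorem sum_smul_eq_classSum_smul {V : Type*} [AddCommGroup V] [Module ℝ V] {M : TSRK s}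
    (a : Fin s ⊕ Fin s → ℝ) (x : Option (Fin s ⊕ Fin s)) (v : V) {g : Fin s ⊕ Fin s → V}
    (h1 : ∀ e, M.SamePoint (some e) x → g e = v)
    (h0 : ∀ e, ¬ M.SamePoint (some e) x → g e = 0) :
    ∑ e, a e • g e = M.classSum a x • v := by
  classical
  rw [classSum, Finset.sum_smul]
  refine Finset.sum_congr rfl fun e _ => ?_
  by_cases he : M.SamePoint (some e) x
  · rw [h1 e he, if_pos he]
  · rw [h0 e he, if_neg he, zero_smul, smul_zero]

/-! ### Sign conditions from monotonicity -/

theorem MonotoneWith.le_of_run {V : Type*} [AddCommGroup V] [Module ℝ V]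
    [FiniteDimensional ℝ V] {M : TSRK s} {C : ℝ} (hM : M.MonotoneWith C) (hC : 0 < C)
    {φ : V → ℝ} (hφ : ConvexOn ℝ Set.univ φ) {F : V → V}
    (hF : ∀ (v : V) (τ : ℝ), 0 ≤ τ → τ ≤ 1 → φ (v + τ • F v) ≤ φ v) {ucur u : V}
    {P : Option (Fin s ⊕ Fin s) → V} (hP : M.Run F C ucur P u) {R : ℝ} (h0 : φ (P none) ≤ R)
    (h1 : φ ucur ≤ R) (h2 : ∀ j, φ (P (some (.inl j))) ≤ R) : φ u ≤ R := by
  let e : V ≃ₗ[ℝ] (Fin (Module.finrank ℝ V) → ℝ) := (Module.finBasis ℝ V).equivFun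
  have hrun := hP.map e.toLinearMap (G := fun w => e (F (e.symm w))) (fun v => by simp)
  have hst := hrun
  rw [← points_eta (fun x => e.toLinearMap (P x)), run_points_iff] at hst
  have := hM _ (fun w => φ (e.symm w)) _ 1
    (hφ.comp_linearMap e.symm.toLinearMap) one_pos
    (fun v τ h1 h2 => by simpa using hF (e.symm v) τ h1 h2) C hC (by simp) _ _ _ _ _
    hst.1 hst.2 R (by simpa using h0) (by simpa using h1) (by simpa using h2)
  simpa using this

/-- The testing device. The base step `P` only labels the evaluation points, so that `G` can
recognise where it is being evaluated; the functional is the maximum of the two added components.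
These vanish at `u^{n-1}` and `u^n`, so the bound is 0. -/
theorem MonotoneWith.exists_extension {M : TSRK s} (hexp : M.IsExplicit) {C : ℝ}
    (hM : M.MonotoneWith C) (hC : 0 < C) {N : ℕ} {F : (Fin N → ℝ) → (Fin N → ℝ)}
    {ucur u : Fin N → ℝ} {P : Option (Fin s ⊕ Fin s) → Fin N → ℝ} (hP : M.Run F C ucur P u)
    (G : (Fin N → ℝ) × ℝ × ℝ → ℝ × ℝ)
    (hG : ∀ (v : (Fin N → ℝ) × ℝ × ℝ) (τ : ℝ), 0 ≤ τ → τ ≤ 1 →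
      max (v.2.1 + τ * (G v).1) (v.2.2 + τ * (G v).2) ≤ max v.2.1 v.2.2)
    (w : Fin s → ℝ × ℝ) (h1 : ∀ j, M.IsCurrentStage j → w j = 0)
    (h2 : ∀ i j, M.SameStage i j → w i = w j) (hw : ∀ j, max (w j).1 (w j).2 ≤ 0) :
    ∃ Q : Option (Fin s ⊕ Fin s) → ℝ × ℝ, (∀ x x', M.SamePoint x x' → Q x = Q x') ∧
      Q none = 0 ∧ (∀ j, Q (some (.inl j)) = w j) ∧
      (∀ i, Q (some (.inr i)) = C • ∑ e, M.weight i e • G (P (some e), Q (some e))) ∧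
      (∑ e, M.outWeight e • G (P (some e), Q (some e))).1 ≤ 0 := by
  obtain ⟨Q, r, hQ, hQ0, hQw⟩ := hexp.exists_extension hP G 0 0 w h1 h2
  have hφ : ConvexOn ℝ Set.univ (fun v : (Fin N → ℝ) × ℝ × ℝ => max v.2.1 v.2.2) :=
    ((LinearMap.fst ℝ ℝ ℝ ∘ₗ LinearMap.snd ℝ (Fin N → ℝ) (ℝ × ℝ)).convexOn convex_univ).sup
      ((LinearMap.snd ℝ ℝ ℝ ∘ₗ LinearMap.snd ℝ (Fin N → ℝ) (ℝ × ℝ)).convexOn convex_univ)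
  have hle := hM.le_of_run hC hφ (fun v τ h1 h2 => by simpa using hG v τ h1 h2) hQ (R := 0)
    (by simp [hQ0]) (by simp) (fun j => by simpa [hQw] using hw j)
  have hsnd := hQ.next
  have hr := congrArg Prod.snd hsnd
  simp only [Prod.snd_add, Prod.smul_snd, Prod.snd_sum, hQ0, smul_zero, zero_add] at hr
  refine ⟨Q, fun x x' hx => congrArg Prod.snd (hx.eq hC hQ), hQ0, hQw, fun i => ?_, ?_⟩
  · have := congrArg Prod.snd (hQ.stage i)
    simpa only [Prod.snd_add, Prod.smul_snd, Prod.snd_sum, hQ0, smul_zero, zero_add] using this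
  · have h3 : r.1 ≤ 0 := (le_max_left _ _).trans hle
    rw [hr, Prod.smul_fst, smul_eq_mul] at h3
    exact nonpos_of_mul_nonpos_right h3 hC

/-- A field that lowers the first component at the class of `x`, and does nothing elsewhere, is
contractive; a negative weight would turn this into growth. -/
theorem IsSSP.classSum_outWeight_nonneg {M : TSRK s} (hexp : M.IsExplicit) (hM : M.IsSSP)
    (x : Option (Fin s ⊕ Fin s)) : 0 ≤ M.classSum M.outWeight x := by
  classical
  obtain ⟨C, hC, hM⟩ := hM
  obtain ⟨N, F, ucur, P, u, hP, hsep⟩ := hexp.exists_separating_run hC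
  obtain ⟨Q, -, -, -, -, hle⟩ := hM.exists_extension hexp hC hP
    (fun v => if v.1 = P x then (-1, 0) else 0) (fun v τ h0 _ => by
      split_ifs
      · exact max_le_max (by simpa using h0) (by simp)
      · simp) 0 (fun _ _ => rfl) (fun _ _ _ => rfl) (by simp)
  rw [sum_smul_eq_classSum_smul M.outWeight x (-1, 0)
    (fun e he => if_pos (he.eq hC hP)) (fun e he => if_neg fun hc => he (hsep _ _ hc))] at hle
  simpa using hle

/-- A free input can be placed at `(-1, 0)`, where raising the first component by at most 1 leaves
the maximum at 0. A positive weight would transfer this hidden growth to the output, which starts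
from 0. -/
theorem IsSSP.classSum_outWeight_inl {M : TSRK s} (hexp : M.IsExplicit) (hM : M.IsSSP)
    {j : Fin s} (hj : ¬ M.SamePoint (some (.inl j)) none) :
    M.classSum M.outWeight (some (.inl j)) = 0 := by
  classical
  refine le_antisymm ?_ (hM.classSum_outWeight_nonneg hexp _)
  obtain ⟨C, hC, hM⟩ := hM
  obtain ⟨N, F, ucur, P, u, hP, hsep⟩ := hexp.exists_separating_run hC
  have hcur : ∀ k, M.IsCurrentStage k → M.SamePoint (some (.inl k)) none :=
    fun k hk N F h _ ucur P u hP => hP.current k hk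
  have hsame : ∀ i k, M.SameStage i k → M.SamePoint (some (.inl i)) (some (.inl k)) :=
    fun i k hk N F h _ ucur P u hP => hP.same i k hk
  obtain ⟨Q, hQ, -, hQw, -, hle⟩ := hM.exists_extension hexp hC hP
    (fun v => if v.1 = P (some (.inl j)) ∧ v.2 = (-1, 0) then (1, 0) else 0)
    (fun v τ h0 h1 => by
      split_ifs with h
      · rw [h.2]
        refine max_le ?_ ?_ <;> simp [h1]
      · simp)
    (fun k => if M.SamePoint (some (.inl k)) (some (.inl j)) then (-1, 0) else 0)
    (fun k hk => if_neg fun hc => hj (hc.symm.trans (hcur k hk)))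
    (fun i k hik => by
      have : M.SamePoint (some (.inl i)) (some (.inl j)) ↔
          M.SamePoint (some (.inl k)) (some (.inl j)) :=
        ⟨fun h => (hsame i k hik).symm.trans h, fun h => (hsame i k hik).trans h⟩
      simp only [this])
    (fun k => by split_ifs <;> simp)
  have hQj : Q (some (.inl j)) = (-1, 0) := by rw [hQw, if_pos (SamePoint.refl _)]
  rw [sum_smul_eq_classSum_smul M.outWeight (some (.inl j)) (1, 0)
    (fun e he => if_pos ⟨he.eq hC hP, (hQ _ _ he).trans hQj⟩)
    (fun e he => if_neg fun hc => he (hsep _ _ hc.1))] at hle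
  simpa using hle

/-! ### Reduction to the stages that matter -/

/-- Stage `i` is the first of its class, differs from `u^{n-1}` and contributes to the new
value. -/
def IsReduced (M : TSRK s) (i : Fin s) : Prop :=
  (∀ j, M.SamePoint (some (.inr j)) (some (.inr i)) → i ≤ j) ∧
  ¬ M.SamePoint (some (.inr i)) none ∧ M.classSum M.outWeight (some (.inr i)) ≠ 0

theorem IsSSP.inr_of_samePoint {M : TSRK s} (hexp : M.IsExplicit) (hM : M.IsSSP)
    {i : Fin s} (hi : M.IsReduced i) {e : Fin s ⊕ Fin s}
    (he : M.SamePoint (some e) (some (.inr i))) : ∃ j, e = .inr j ∧ i ≤ j := by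
  rcases e with j | j
  · refine absurd ?_ hi.2.2
    rw [← classSum_congr _ he]
    exact hM.classSum_outWeight_inl hexp fun hc => hi.2.1 (he.symm.trans hc)
  · exact ⟨j, rfl, hi.1 j he⟩

theorem IsSSP.classSum_weight_of_le {M : TSRK s} (hexp : M.IsExplicit) (hM : M.IsSSP)
    {i k : Fin s} (hi : M.IsReduced i) (hk : k ≤ i) :
    M.classSum (M.weight k) (some (.inr i)) = 0 := by
  by_contra hne
  obtain ⟨e, he, h0⟩ := exists_mem_of_classSum_ne_zero hne
  obtain ⟨j, rfl, hj⟩ := hM.inr_of_samePoint hexp hi he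
  exact h0 (hexp k j (hk.trans hj))

/-- A stage with positive weight in the new value only uses points with positive weight. -/
theorem IsSSP.classSum_weight_eq_zero {M : TSRK s} (hexp : M.IsExplicit) (hM : M.IsSSP)
    {i : Fin s} (hi : M.IsReduced i) {x : Option (Fin s ⊕ Fin s)}
    (hx : M.classSum M.outWeight x = 0) : M.classSum (M.weight i) x = 0 := by
  classical
  have hpos : 0 < M.classSum M.outWeight (some (.inr i)) :=
    lt_of_le_of_ne (hM.classSum_outWeight_nonneg hexp _) hi.2.2.symm
  have hdiag := hM.classSum_weight_of_le hexp hi le_rfl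
  have hxi : ¬ M.SamePoint x (some (.inr i)) := fun hc => hi.2.2 (by rw [← classSum_congr _ hc, hx])
  obtain ⟨C, hC, hM⟩ := hM
  obtain ⟨N, F, ucur, P, u, hP, hsep⟩ := hexp.exists_separating_run hC
  set α := M.classSum (M.weight i) x with hα
  by_contra hne
  -- The field is `D` at `x`, which the output does not see, and moves stage `i` to `(C * α) • D`.
  -- There one component lies `C * |α|` below the other, so the field may raise it by `C * |α|`
  -- unnoticed; the output does see this. The sign of `α` decides which component of `D` is `-1`.
  have main : ∀ D : ℝ × ℝ, D.1 ≤ 0 → D.2 ≤ 0 →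
      (∀ τ : ℝ, 0 ≤ τ → τ ≤ 1 → max (C * α * D.1 + τ * (C * |α|)) (C * α * D.2) ≤
        max (C * α * D.1) (C * α * D.2)) → False := by
    intro D hD1 hD2 hD
    obtain ⟨Q, hQ, -, -, hQs, hle⟩ := hM.exists_extension hexp hC hP
      (fun v => if v.1 = P x then D else
        if v.1 = P (some (.inr i)) ∧ v.2 = (C * α) • D then (C * |α|, 0) else 0)
      (fun v τ h0 h1 => by
        split_ifs with h h
        · exact max_le_max (by nlinarith) (by nlinarith)
        · rw [h.2]
          simpa using hD τ h0 h1
        · simp) 0 (fun _ _ => rfl) (fun _ _ _ => rfl) (by simp)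
    set v₀ : ℝ × ℝ := if Q (some (.inr i)) = (C * α) • D then (C * |α|, 0) else 0 with hv₀
    have hsum : ∀ a : Fin s ⊕ Fin s → ℝ,
        (∑ e, a e • if P (some e) = P x then D else
          if P (some e) = P (some (.inr i)) ∧ Q (some e) = (C * α) • D then (C * |α|, 0)
            else 0) = M.classSum a x • D + M.classSum a (some (.inr i)) • v₀ := by
      intro a
      rw [← sum_smul_eq_classSum_smul a x D
        (g := fun e => if P (some e) = P x then D else 0)
        (fun e he => if_pos (he.eq hC hP)) (fun e he => if_neg fun hc => he (hsep _ _ hc)),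
        ← sum_smul_eq_classSum_smul a (some (.inr i)) v₀
        (g := fun e => if P (some e) = P (some (.inr i)) then v₀ else 0)
        (fun e he => if_pos (he.eq hC hP)) (fun e he => if_neg fun hc => he (hsep _ _ hc)),
        ← Finset.sum_add_distrib]
      refine Finset.sum_congr rfl fun e _ => ?_
      rw [← smul_add]
      congr 1
      by_cases h1 : P (some e) = P x
      · have h2 : P (some e) ≠ P (some (.inr i)) :=
          fun hc => hxi ((hsep _ _ h1).symm.trans (hsep _ _ hc))
        rw [if_pos h1, if_pos h1, if_neg h2, add_zero]
      · by_cases h2 : P (some e) = P (some (.inr i))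
        · rw [if_neg h1, if_neg h1, if_pos h2, zero_add, hv₀, ← hQ _ _ (hsep _ _ h2)]
          simp only [h2, true_and]
        · rw [if_neg h1, if_neg h1, if_neg h2, if_neg fun hc => h2 hc.1, add_zero]
    -- No circularity: by `hdiag` the value `v₀` at stage `i` does not influence that stage.
    have hQi : Q (some (.inr i)) = (C * α) • D := by
      rw [hQs i, hsum, hdiag, zero_smul, add_zero, smul_smul]
    rw [hsum, hx, zero_smul, zero_add, hv₀, if_pos hQi] at hle
    have hα0 : 0 < |α| := abs_pos.mpr hne
    have : 0 < M.classSum M.outWeight (some (.inr i)) * (C * |α|) := by positivity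
    simp only [Prod.smul_fst, smul_eq_mul] at hle
    linarith
  rcases lt_or_gt_of_ne hne with hneg | hpos'
  · refine main (0, -1) le_rfl (by simp) fun τ h0 h1 => ?_
    rw [abs_of_neg hneg]
    have : 0 ≤ C * -α := by nlinarith
    refine max_le (le_max_of_le_right ?_) (le_max_right _ _)
    simp only
    nlinarith
  · refine main (-1, 0) (by simp) le_rfl fun τ h0 h1 => ?_
    rw [abs_of_pos hpos']
    have : 0 ≤ C * α := by nlinarith
    refine max_le (le_max_of_le_right ?_) (le_max_right _ _)
    simp only
    nlinarith

/-- The stages `i` with `M.IsReduced i`. -/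
noncomputable def reducedStages (M : TSRK s) : Finset (Fin s) :=
  open Classical in Finset.univ.filter M.IsReduced

theorem mem_reducedStages {M : TSRK s} {i : Fin s} : i ∈ M.reducedStages ↔ M.IsReduced i := by
  simp [reducedStages]

/-- A sum over all evaluation points, in terms of `u^{n-1}` and the reduced stages. -/
theorem IsSSP.sum_weight_eq {V : Type*} [AddCommGroup V] [Module ℝ V] {M : TSRK s}
    (hexp : M.IsExplicit) (hM : M.IsSSP) {a : Fin s ⊕ Fin s → ℝ}
    (ha : ∀ x, M.classSum M.outWeight x = 0 → M.classSum a x = 0)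
    {g : Option (Fin s ⊕ Fin s) → V} (hg : ∀ x x', M.SamePoint x x' → g x = g x') :
    ∑ e, a e • g (some e) = M.classSum a none • g none +
      ∑ i ∈ M.reducedStages, M.classSum a (some (.inr i)) • g (some (.inr i)) := by
  classical
  have hout : ∀ x, M.SamePoint (Quotient.out (Quotient.mk M.samePointSetoid x)) x :=
    fun x => Quotient.mk_out (s := M.samePointSetoid) x
  let f : Quotient M.samePointSetoid → V := fun q => M.classSum a q.out • g q.out
  have hf : ∀ x, f (Quotient.mk _ x) = M.classSum a x • g x := fun x => by
    simp only [f, classSum_congr a (hout x), hg _ _ (hout x)]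
  have hall : ∑ e, a e • g (some e) = ∑ q, f q := by
    rw [← Finset.sum_fiberwise (s := Finset.univ)
      (g := fun e : Fin s ⊕ Fin s => Quotient.mk M.samePointSetoid (some e))]
    refine Finset.sum_congr rfl fun q _ => ?_
    simp only [f]
    rw [← sum_smul_eq_classSum_smul a q.out (g q.out)
      (g := fun e => if M.SamePoint (some e) q.out then g (some e) else 0)
      (fun e he => by rw [if_pos he, hg _ _ he]) (fun e he => if_neg he), Finset.sum_filter]
    refine Finset.sum_congr rfl fun e _ => ?_
    have : Quotient.mk M.samePointSetoid (some e) = q ↔ M.SamePoint (some e) q.out := by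
      conv_lhs => rw [← Quotient.out_eq q]
      exact Quotient.eq
    simp only [this]
    split_ifs <;> simp
  let r : Option (Fin s) → Quotient M.samePointSetoid :=
    fun o => Quotient.mk _ (o.map Sum.inr)
  let T : Finset (Option (Fin s)) := Finset.insertNone M.reducedStages
  have hT : ∑ q, f q = ∑ o ∈ T, f (r o) := by
    symm
    rw [← Finset.sum_image (s := T) (g := r) (f := f)]
    -- A class of nonzero output weight other than that of `u^{n-1}` contains a current stage, and
    -- its first one is reduced; all remaining classes drop out by `ha`.
    · refine Finset.sum_subset (Finset.subset_univ _) fun q _ hq => ?_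
      obtain ⟨x, rfl⟩ := Quotient.exists_rep q
      rw [hf]
      have hx0 : ¬ M.SamePoint x none := fun hc => hq (Finset.mem_image.mpr
        ⟨none, by simp [T], (Quotient.sound (s := M.samePointSetoid) hc).symm⟩)
      by_cases hx : M.classSum M.outWeight x = 0
      · rw [ha x hx, zero_smul]
      exfalso
      have hex : ∃ j, M.SamePoint (some (.inr j)) x := by
        rcases x with _ | j | j
        · exact absurd (SamePoint.refl _) hx0
        · exact absurd (hM.classSum_outWeight_inl hexp hx0) hx
        · exact ⟨j, SamePoint.refl _⟩
      obtain ⟨j, hj⟩ := hex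
      obtain ⟨i, hi, hmin⟩ := Finset.exists_min_image
        (Finset.univ.filter fun j => M.SamePoint (some (.inr j)) x) id ⟨j, by simpa using hj⟩
      simp only [Finset.mem_filter, Finset.mem_univ, true_and, id] at hi hmin
      refine hq (Finset.mem_image.mpr ⟨some i, ?_, Quotient.sound (s := M.samePointSetoid) hi⟩)
      simp only [T, Finset.some_mem_insertNone, mem_reducedStages]
      exact ⟨fun k hk => hmin k (hk.trans hi), fun hc => hx0 (hi.symm.trans hc),
        by rwa [classSum_congr _ hi]⟩
    · intro o ho o' ho' h
      have h' : M.SamePoint (o.map Sum.inr) (o'.map Sum.inr) := Quotient.exact h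
      rcases o with _ | i <;> rcases o' with _ | i'
      · rfl
      · exact absurd h'.symm (by simpa [T, mem_reducedStages] using ho' : M.IsReduced i').2.1
      · exact absurd h' (by simpa [T, mem_reducedStages] using ho : M.IsReduced i).2.1
      · have hi : M.IsReduced i := by simpa [T, mem_reducedStages] using ho
        have hi' : M.IsReduced i' := by simpa [T, mem_reducedStages] using ho'
        rw [le_antisymm (hi.1 i' h'.symm) (hi'.1 i h')]
  rw [hall, hT, Finset.sum_insertNone, hf]
  exact congrArg _ (Finset.sum_congr rfl fun i _ => hf _)

theorem Run.stage_reduced {V : Type*} [AddCommGroup V] [Module ℝ V] [FiniteDimensional ℝ V]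
    {M : TSRK s} (hexp : M.IsExplicit) (hM : M.IsSSP) {F : V → V} {h : ℝ} (hh : 0 < h) {ucur u : V}
    {P : Option (Fin s ⊕ Fin s) → V} (hP : M.Run F h ucur P u) {i : Fin s} (hi : M.IsReduced i) :
    P (some (.inr i)) = M.d i • P none + (1 - M.d i) • ucur
      + h • (M.classSum (M.weight i) none • F (P none)
        + ∑ j ∈ M.reducedStages, M.classSum (M.weight i) (some (.inr j)) •
          F (P (some (.inr j)))) := by
  rw [hP.stage i, hM.sum_weight_eq hexp (fun x => hM.classSum_weight_eq_zero hexp hi)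
    (g := fun x => F (P x)) (fun x x' hx => by rw [hx.eq hh hP])]

theorem Run.next_reduced {V : Type*} [AddCommGroup V] [Module ℝ V] [FiniteDimensional ℝ V]
    {M : TSRK s} (hexp : M.IsExplicit) (hM : M.IsSSP) {F : V → V} {h : ℝ} (hh : 0 < h) {ucur u : V}
    {P : Option (Fin s ⊕ Fin s) → V} (hP : M.Run F h ucur P u) :
    u = M.θ • P none + (1 - M.θ) • ucur
      + h • (M.classSum M.outWeight none • F (P none)
        + ∑ j ∈ M.reducedStages, M.classSum M.outWeight (some (.inr j)) •
          F (P (some (.inr j)))) := by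
  rw [hP.next, hM.sum_weight_eq hexp (fun x => id)
    (g := fun x => F (P x)) (fun x x' hx => by rw [hx.eq hh hP])]

/-! ### Local error from admissible inputs -/

section LocalError

open Filter Topology Asymptotics

/-- A method of order `p` also has a local error `O(h^(p+1))` when the stage values of the
previous step are chosen admissible. -/
theorem HasOrder.exists_runs {M : TSRK s} (hexp : M.IsExplicit) {p : ℕ} (hM : M.HasOrder p)
    (hp : p ≠ 0) {N : ℕ} {F : (Fin N → ℝ) → (Fin N → ℝ)} {u : ℝ → Fin N → ℝ}
    (hF : ContDiff ℝ ((⊤ : ℕ∞) : WithTop ℕ∞) F) (hu : ∀ t, HasDerivAt u (F (u t)) t) :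
    ∃ (P : ℝ → Option (Fin s ⊕ Fin s) → Fin N → ℝ) (U : ℝ → Fin N → ℝ),
      (∀ h, M.Run F h (u 0) (P h) (U h)) ∧ (∀ h, P h none = u (-h)) ∧
      (fun h => U h - u h) =O[𝓝[>] 0] fun h => h ^ (p + 1) := by
  obtain ⟨Y, ε, K, hε, hY, hst⟩ := hM N F u 1 hF one_pos fun t _ => hu t
  -- The values `Y` need not be admissible, but the stages `y₁` produced by a genuine preceding step
  -- are, and they differ from `Y h (-h)` by `O(h^p)`. They replace `Y h (-h)` as inputs; `y₂`
  -- belongs to the step with the original inputs, for comparison.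
  choose y₁ U₁ h₁ using fun h : ℝ => hexp.exists_isStep F h (u (-h - h)) (u (-h)) (Y h (-h - h))
  choose y₂ U₂ h₂ using fun h : ℝ => hexp.exists_isStep F h (u (-h)) (u 0) (Y h (-h))
  have hadm : ∀ h, M.AdmissibleInput (u (-h)) (y₁ h) := by
    intro h
    refine ⟨fun j hj => ?_, fun i j hij => ?_⟩
    · rw [(h₁ h).1 j, hj.1]
      simp [hj.2.1, hj.2.2]
    · rw [(h₁ h).1 i, (h₁ h).1 j, hij.1]
      simp only [hij.2.1, hij.2.2]
  choose P U hrun hP0 hPl using fun h : ℝ =>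
    hexp.exists_run F h (u (-h)) (u 0) (y₁ h) (hadm h).1 (hadm h).2
  refine ⟨P, U, hrun, hP0, ?_⟩
  set l : Filter ℝ := 𝓝[>] 0
  have hpos : ∀ᶠ h : ℝ in l, 0 < h := self_mem_nhdsWithin
  have hid : Tendsto (fun h : ℝ => h) l (𝓝 0) := tendsto_id.mono_left nhdsWithin_le_nhds
  have hpow : Tendsto (fun h : ℝ => h ^ p) l (𝓝 0) := by simpa [hp] using hid.pow p
  have hsmall : ∀ᶠ h in l, h ∈ Set.Ioo 0 ε ∧ -h ∈ Set.Ioo (-ε) ε ∧ (0 : ℝ) ∈ Set.Ioo (-ε) ε := by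
    filter_upwards [Ioo_mem_nhdsGT hε] with h hh
    exact ⟨hh, ⟨by linarith [hh.2], by linarith [hh.1]⟩, by linarith, hε⟩
  have hunif : ∀ {f g : ℝ → Fin N → ℝ} {k : ℕ}, (∀ᶠ h in l, ‖f h - g h‖ ≤ K * h ^ k) →
      (fun h => f h - g h) =O[l] fun h => h ^ k := by
    intro f g k hfg
    refine IsBigO.of_bound K ?_
    filter_upwards [hfg, hpos] with h hh h0
    rwa [Real.norm_of_nonneg (pow_pos h0 k).le]
  have hlim : ∀ {f g : ℝ → Fin N → ℝ} {k : ℕ} {c : Fin N → ℝ}, k ≠ 0 →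
      ((fun h => f h - g h) =O[l] fun h => h ^ k) → Tendsto g l (𝓝 c) → Tendsto f l (𝓝 c) := by
    intro f g k c hk hfg hg
    have := (hfg.trans_tendsto (by simpa [hk] using hid.pow k)).add hg
    simpa using this
  have hu0 : Tendsto (fun h => u (-h)) l (𝓝 (u 0)) := by
    have hc : Tendsto (fun h : ℝ => -h) l (𝓝 0) := by simpa using hid.neg
    exact (hu 0).continuousAt.tendsto.comp hc
  have hYl : ∀ j, Tendsto (fun h => Y h (-h) j) l (𝓝 (u 0)) := fun j =>
    hlim one_ne_zero (hunif (k := 1) (by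
      filter_upwards [hsmall] with h hh
      simpa using hY h hh.1 _ hh.2.1 j)) hu0
  have hy₁ : ∀ j, (fun h => y₁ h j - Y h (-h) j) =O[l] fun h => h ^ p := fun j =>
    hunif (by
      filter_upwards [hsmall] with h hh
      exact (hst h hh.1 _ hh.2.1 _ _ (h₁ h)).1 j)
  have hst₂ : ∀ᶠ h in l, (∀ i, ‖y₂ h i - Y h 0 i‖ ≤ K * h ^ p) ∧
      ‖U₂ h - u h‖ ≤ K * h ^ (p + 1) := by
    filter_upwards [hsmall] with h hh
    simpa using hst h hh.1 0 hh.2.2 (y₂ h) (U₂ h) (by simpa using h₂ h)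
  have hy₂ : ∀ j, Tendsto (fun h => y₂ h j) l (𝓝 (u 0)) := fun j =>
    hlim hp (hunif (hst₂.mono fun h hh => hh.1 j)) (hlim one_ne_zero (hunif (k := 1) (by
      filter_upwards [hsmall] with h hh
      simpa using hY h hh.1 _ hh.2.2 j)) (tendsto_const_nhds (x := u 0)))
  set P₂ : ℝ → Option (Fin s ⊕ Fin s) → Fin N → ℝ := fun h => points (u (-h)) (Y h (-h)) (y₂ h)
  have hlip : ∀ {f g : ℝ → Fin N → ℝ}, Tendsto g l (𝓝 (u 0)) →
      ((fun h => f h - g h) =O[l] fun h => h ^ p) →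
      (fun h => F (f h) - F (g h)) =O[l] fun h => h ^ p := by
    intro f g hg hfg
    have hs : HasStrictFDerivAt F (fderiv ℝ F (u 0)) (u 0) :=
      hF.contDiffAt.hasStrictFDerivAt (by simp)
    exact (hs.isBigO_sub.comp_tendsto ((hlim hp hfg hg).prodMk_nhds hg)).trans hfg
  -- The factor `h` in front of the sum turns input errors `O(h^p)` into output errors `O(h^(p+1))`.
  have hsum : ∀ a : Fin s ⊕ Fin s → ℝ,
      (∀ e, a e ≠ 0 → (fun h => P h (some e) - P₂ h (some e)) =O[l] fun h => h ^ p) →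
      (fun h => h • ∑ e, a e • F (P h (some e)) - h • ∑ e, a e • F (P₂ h (some e))) =O[l]
        fun h => h ^ (p + 1) := by
    intro a ha
    have h1 : (fun h => ∑ e, a e • (F (P h (some e)) - F (P₂ h (some e)))) =O[l]
        fun h => h ^ p := by
      refine IsBigO.fun_sum fun e _ => ?_
      by_cases he : a e = 0
      · simp only [he, zero_smul]
        exact isBigO_zero _ _
      · have hlim₂ : Tendsto (fun h => P₂ h (some e)) l (𝓝 (u 0)) := by
          rcases e with j | j
          exacts [hYl j, hy₂ j]
        exact (hlip hlim₂ (ha e he)).const_smul_left (a e)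
    have h2 := (isBigO_refl (fun h : ℝ => h) l).smul h1
    refine (h2.congr_left fun h => ?_).congr_right fun h => ?_
    · simp only [← smul_sub, ← Finset.sum_sub_distrib]
    · simp [pow_succ']
  have hle : (fun h : ℝ => h ^ (p + 1)) =O[l] fun h => h ^ p := by
    have := (hid.isBigO_one ℝ).mul (isBigO_refl (fun h : ℝ => h ^ p) l)
    simpa [pow_succ'] using this
  have hinl : ∀ j, (fun h => P h (some (.inl j)) - P₂ h (some (.inl j))) =O[l]
      fun h => h ^ p := fun j => by
    simp only [hPl]
    exact hy₁ j
  have hinr : ∀ i, (fun h => P h (some (.inr i)) - P₂ h (some (.inr i))) =O[l]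
      fun h => h ^ p := by
    intro i
    induction i using WellFoundedLT.induction with
    | ind i ih =>
      refine ((hsum (M.weight i) ?_).trans hle).congr_left fun h => ?_
      · rintro (j | j) hj
        · exact hinl j
        · exact ih j (not_le.mp fun hc => hj (hexp i j hc))
      · rw [(hrun h).stage i, hP0]
        have := (M.isStep_iff.mp (h₂ h)).1 i
        simp only [P₂]
        conv_rhs => rw [points, this]
        abel
  have hfin : (fun h => U h - U₂ h) =O[l] fun h => h ^ (p + 1) := by
    refine (hsum M.outWeight ?_).congr_left fun h => ?_
    · rintro (j | j) _
      exacts [hinl j, hinr j]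
    · rw [(hrun h).next, hP0, (M.isStep_iff.mp (h₂ h)).2]
      abel
  have := hfin.add (hunif (hst₂.mono fun h hh => hh.2))
  simpa using this

end LocalError

/-! ### Quadrature conditions for the output and the stages -/

section MomentConditions

open Filter Topology Asymptotics

/-- The abscissa of a stage. -/
noncomputable def abscissa (M : TSRK s) (i : Fin s) : ℝ :=
  -M.d i + (M.classSum (M.weight i) none
    + ∑ j ∈ M.reducedStages, M.classSum (M.weight i) (some (.inr j)))

/-- `h^(-k)` times the value of a stage for the quadrature problem with solution `t^k`,
where `k = m + 1`. -/
noncomputable def stageMoment (M : TSRK s) (m : ℕ) (i : Fin s) : ℝ :=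
  M.d i * (-1) ^ (m + 1) + (m + 1) * (M.classSum (M.weight i) none * (-1) ^ m
    + ∑ j ∈ M.reducedStages, M.classSum (M.weight i) (some (.inr j)) * M.abscissa j ^ m)

theorem eq_zero_of_isBigO_pow {a : ℝ} {m n : ℕ} (hmn : m < n)
    (h : (fun x : ℝ => a * x ^ m) =O[𝓝[>] 0] fun x => x ^ n) : a = 0 := by
  obtain ⟨k, rfl⟩ := Nat.exists_eq_add_of_lt hmn
  have hid : Tendsto (fun h : ℝ => h) (𝓝[>] 0) (𝓝 0) := tendsto_id.mono_left nhdsWithin_le_nhds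
  have hpos : ∀ᶠ h : ℝ in 𝓝[>] 0, 0 < h := self_mem_nhdsWithin
  have h2 : (fun _ : ℝ => a) =O[𝓝[>] 0] fun x : ℝ => x ^ (k + 1) := by
    refine ((h.mul (isBigO_refl (fun x : ℝ => (x ^ m)⁻¹) _)).congr' ?_ ?_)
    · filter_upwards [hpos] with x hx
      field_simp
    · filter_upwards [hpos] with x hx
      field_simp
      ring
  have h3 := h2.trans_tendsto (by simpa using hid.pow (k + 1))
  exact tendsto_nhds_unique tendsto_const_nhds h3

/-- With solution `(t, t^(m+1), 0)`, the second component tests quadrature of the output, and the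
third accumulates the squared stage defects. These carry nonnegative weights, so there is no
cancellation and each defect vanishes. -/
theorem HasOrder.moment_conditions {M : TSRK s} (hexp : M.IsExplicit) (hssp : M.IsSSP) {p : ℕ}
    (hM : M.HasOrder p) {m : ℕ} (hm : m + 1 ≤ p) :
    M.θ * (-1) ^ (m + 1) + (m + 1) * (M.classSum M.outWeight none * (-1) ^ m
      + ∑ j ∈ M.reducedStages, M.classSum M.outWeight (some (.inr j)) * M.abscissa j ^ m) = 1 ∧
    (2 * m + 3 ≤ p → ∀ i, M.IsReduced i → M.stageMoment m i = M.abscissa i ^ (m + 1)) := by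
  set F : (Fin 3 → ℝ) → (Fin 3 → ℝ) :=
    fun v => ![1, (m + 1) * v 0 ^ m, (v 1 - v 0 ^ (m + 1)) ^ 2] with hF
  set u : ℝ → Fin 3 → ℝ := fun t => ![t, t ^ (m + 1), 0] with hu
  have hFs : ContDiff ℝ ((⊤ : ℕ∞) : WithTop ℕ∞) F := by
    rw [contDiff_pi]
    intro i
    fin_cases i <;> simp [hF] <;> fun_prop
  have hud : ∀ t, HasDerivAt u (F (u t)) t := by
    intro t
    rw [hasDerivAt_pi]
    intro i
    fin_cases i
    · simpa [hu, hF] using hasDerivAt_id' t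
    · simpa [hu, hF] using hasDerivAt_pow (m + 1) t
    · simpa [hu, hF] using hasDerivAt_const t (0 : ℝ)
  obtain ⟨P, U, hrun, hP0, hU⟩ := hM.exists_runs hexp (by omega) hFs hud
  have hu0 : u 0 = 0 := by
    ext i; fin_cases i <;> simp [hu]
  have hF0 : ∀ v, F v 0 = 1 := fun v => rfl
  have hF1 : ∀ v, F v 1 = (m + 1) * v 0 ^ m := fun v => rfl
  have hF2 : ∀ v, F v 2 = (v 1 - v 0 ^ (m + 1)) ^ 2 := fun v => rfl
  have hu0' : ∀ t, u t 0 = t := fun t => rfl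
  have hu1 : ∀ t, u t 1 = t ^ (m + 1) := fun t => rfl
  have hu2 : ∀ t, u t 2 = 0 := fun t => rfl
  have ht : ∀ h > 0, ∀ i, M.IsReduced i → P h (some (.inr i)) 0 = M.abscissa i * h := by
    intro h hh i hi
    have := congrFun ((hrun h).stage_reduced hexp hssp hh hi) 0
    simp only [hP0, hu0, Pi.add_apply, Pi.smul_apply, Finset.sum_apply, smul_eq_mul,
      Pi.zero_apply, mul_zero, add_zero, hF0, hu0', mul_one] at this
    rw [this, abscissa]
    ring
  have hv : ∀ h > 0, ∀ i, M.IsReduced i →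
      P h (some (.inr i)) 1 = M.stageMoment m i * h ^ (m + 1) := by
    intro h hh i hi
    have := congrFun ((hrun h).stage_reduced hexp hssp hh hi) 1
    simp only [hP0, hu0, Pi.add_apply, Pi.smul_apply, Finset.sum_apply, smul_eq_mul,
      Pi.zero_apply, mul_zero, add_zero, hF1, hu0', hu1] at this
    rw [this]
    have hs : ∑ j ∈ M.reducedStages, M.classSum (M.weight i) (some (.inr j)) *
        ((m + 1) * P h (some (.inr j)) 0 ^ m) = (m + 1) * h ^ m * ∑ j ∈ M.reducedStages,
          M.classSum (M.weight i) (some (.inr j)) * M.abscissa j ^ m := by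
      rw [Finset.mul_sum]
      refine Finset.sum_congr rfl fun j hj => ?_
      rw [ht h hh j (mem_reducedStages.mp hj)]
      ring
    rw [hs, stageMoment]
    rw [neg_pow h, neg_pow h]
    ring
  rw [isBigO_pi] at hU
  have hpos : ∀ᶠ h : ℝ in 𝓝[>] 0, 0 < h := self_mem_nhdsWithin
  constructor
  · rw [← sub_eq_zero]
    refine eq_zero_of_isBigO_pow (m := m + 1) (n := p + 1) (by omega) ?_
    refine (hU 1).congr' ?_ (EventuallyEq.refl _ _)
    filter_upwards [hpos] with h hh
    have := congrFun ((hrun h).next_reduced hexp hssp hh) 1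
    simp only [hP0, hu0, Pi.add_apply, Pi.smul_apply, Finset.sum_apply, smul_eq_mul,
      Pi.zero_apply, mul_zero, add_zero, hF1, hu0', hu1] at this
    rw [Pi.sub_apply, this]
    have hs : ∑ j ∈ M.reducedStages, M.classSum M.outWeight (some (.inr j)) *
        ((m + 1) * P h (some (.inr j)) 0 ^ m) = (m + 1) * h ^ m * ∑ j ∈ M.reducedStages,
          M.classSum M.outWeight (some (.inr j)) * M.abscissa j ^ m := by
      rw [Finset.mul_sum]
      refine Finset.sum_congr rfl fun j hj => ?_
      rw [ht h hh j (mem_reducedStages.mp hj)]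
      ring
    rw [hs, hu1, neg_pow h, neg_pow h]
    ring
  · intro hmp
    have hzero : ∑ j ∈ M.reducedStages, M.classSum M.outWeight (some (.inr j)) *
        (M.stageMoment m j - M.abscissa j ^ (m + 1)) ^ 2 = 0 := by
      -- The squared defect scales as `h^(2m+2)`, and the step contributes another `h`; this is
      -- below the error order exactly when `2m + 3 ≤ p`. The point `u^{n-1}` lies on the solution
      -- and has no defect.
      refine eq_zero_of_isBigO_pow (m := 2 * m + 3) (n := p + 1) (by omega) ?_
      refine (hU 2).congr' ?_ (EventuallyEq.refl _ _)
      filter_upwards [hpos] with h hh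
      have := congrFun ((hrun h).next_reduced hexp hssp hh) 2
      simp only [hP0, hu0, Pi.add_apply, Pi.smul_apply, Finset.sum_apply, smul_eq_mul,
      Pi.zero_apply, mul_zero, add_zero, hF2, hu0', hu1, hu2] at this
      rw [Pi.sub_apply, this]
      have hs : ∑ j ∈ M.reducedStages, M.classSum M.outWeight (some (.inr j)) *
          (P h (some (.inr j)) 1 - P h (some (.inr j)) 0 ^ (m + 1)) ^ 2 =
          h ^ (2 * m + 2) * ∑ j ∈ M.reducedStages, M.classSum M.outWeight (some (.inr j)) *
            (M.stageMoment m j - M.abscissa j ^ (m + 1)) ^ 2 := by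
        rw [Finset.mul_sum]
        refine Finset.sum_congr rfl fun j hj => ?_
        rw [ht h hh j (mem_reducedStages.mp hj), hv h hh j (mem_reducedStages.mp hj)]
        ring
      rw [hs, hu2]
      ring
    intro i hi
    rw [Finset.sum_eq_zero_iff_of_nonneg fun j _ =>
      mul_nonneg (hssp.classSum_outWeight_nonneg hexp _) (sq_nonneg _)] at hzero
    have := hzero i (mem_reducedStages.mpr hi)
    rw [mul_eq_zero, or_iff_right hi.2.2, sq_eq_zero_iff, sub_eq_zero] at this
    exact this

end MomentConditions

/-! ### The first nontrivial stage -/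

/-- Inputs of all other stages are free: they can be 1 while `u^{n-1} = 0`. -/
theorem isCurrentStage_of_samePoint {M : TSRK s} (hexp : M.IsExplicit) {j : Fin s}
    (hj : M.SamePoint (some (.inl j)) none) : M.IsCurrentStage j := by
  classical
  by_contra hc
  obtain ⟨P, u, hP, h0, hl⟩ := hexp.exists_run (V := Fin 1 → ℝ) (fun _ => 0) 1 0 0
    (fun k => if M.IsCurrentStage k then 0 else 1) (fun k hk => if_pos hk) (fun i k hik => by
      have : M.IsCurrentStage i ↔ M.IsCurrentStage k := by
        simp only [IsCurrentStage, hik.1, hik.2.1, hik.2.2]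
      simp only [this])
  have := hj _ _ 1 one_pos _ _ _ hP
  rw [h0, hl, if_neg hc] at this
  exact one_ne_zero this

theorem hasStageEqPrev_of_classSum_ne_zero {M : TSRK s} (hexp : M.IsExplicit) {i : Fin s}
    (hi : M.classSum (M.weight i) none ≠ 0) : M.HasStageEqPrev := by
  obtain ⟨e, he, h0⟩ := exists_mem_of_classSum_ne_zero hi
  rcases e with j | j
  · exact .inr ⟨j, isCurrentStage_of_samePoint hexp he, .inr ⟨i, h0⟩⟩
  · exact .inl ⟨j, fun N F h hh uprev ucur yprev y unext hadm hst =>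
      he N F h hh ucur _ unext (M.run_points_iff.mpr ⟨hadm, hst⟩)⟩

/-- After reduction, the formula of stage `i` is `y_i^n = u^n`. -/
def IsTrivialStage (M : TSRK s) (i : Fin s) : Prop :=
  M.d i = 0 ∧ M.classSum (M.weight i) none = 0 ∧
    ∀ j, M.IsReduced j → M.classSum (M.weight i) (some (.inr j)) = 0

theorem IsTrivialStage.abscissa_eq_zero {M : TSRK s} {i : Fin s} (hi : M.IsTrivialStage i) :
    M.abscissa i = 0 := by
  rw [abscissa, hi.1, hi.2.1,
    Finset.sum_eq_zero fun j hj => hi.2.2 j (mem_reducedStages.mp hj)]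
  simp

/-- Both stages always equal `u^n`, so they form one class, of which a reduced stage is the first
member. -/
theorem IsTrivialStage.unique {M : TSRK s} (hexp : M.IsExplicit) (hssp : M.IsSSP) {i j : Fin s}
    (hi : M.IsReduced i) (hj : M.IsReduced j) (hi' : M.IsTrivialStage i)
    (hj' : M.IsTrivialStage j) : i = j := by
  have key : ∀ k, M.IsReduced k → M.IsTrivialStage k → ∀ {N : ℕ} {F : (Fin N → ℝ) → (Fin N → ℝ)}
      {h : ℝ} {ucur u : Fin N → ℝ} {P : Option (Fin s ⊕ Fin s) → Fin N → ℝ}, 0 < h →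
      M.Run F h ucur P u → P (some (.inr k)) = ucur := by
    intro k hk hk' N F h ucur u P hh hP
    rw [hP.stage_reduced hexp hssp hh hk, hk'.1, hk'.2.1, Finset.sum_eq_zero fun j hj => by
      rw [hk'.2.2 j (mem_reducedStages.mp hj), zero_smul]]
    simp
  have hij : M.SamePoint (some (.inr i)) (some (.inr j)) := fun N F h hh ucur P u hP => by
    rw [key i hi hi' hh hP, key j hj hj' hh hP]
  exact le_antisymm (hi.1 j hij.symm) (hj.1 i hij)

/-- Otherwise all abscissae are 0, and with `κ` the weight of `F (u^{n-1})` the conditions read `θ -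
2κ = 1`, `-θ + 3κ = 1`, `θ - 4κ = 1`, which is inconsistent. -/
theorem HasOrder.exists_nontrivial {M : TSRK s} (hexp : M.IsExplicit) (hssp : M.IsSSP) {p : ℕ}
    (hM : M.HasOrder p) (hp : 4 ≤ p) : ∃ i, M.IsReduced i ∧ ¬ M.IsTrivialStage i := by
  by_contra! hall
  have hsum : ∀ m : ℕ, m ≠ 0 → ∑ j ∈ M.reducedStages,
      M.classSum M.outWeight (some (.inr j)) * M.abscissa j ^ m = 0 := fun m hm =>
    Finset.sum_eq_zero fun j hj => by
      rw [(hall j (mem_reducedStages.mp hj)).abscissa_eq_zero, zero_pow hm, mul_zero]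
  have h1 := (hM.moment_conditions hexp hssp (m := 1) (by omega)).1
  have h2 := (hM.moment_conditions hexp hssp (m := 2) (by omega)).1
  have h3 := (hM.moment_conditions hexp hssp (m := 3) (by omega)).1
  rw [hsum _ (by norm_num)] at h1 h2 h3
  norm_num at h1 h2 h3
  linarith

/-- The first nontrivial stage of a method of order seven. -/
theorem HasOrder.first_nontrivial {M : TSRK s} (hexp : M.IsExplicit) (hssp : M.IsSSP) {p : ℕ}
    (hM : M.HasOrder p) (hp : 7 ≤ p) :
    p ≤ 8 ∧ (∃ i, M.IsReduced i ∧ M.classSum (M.weight i) none ≠ 0) ∧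
      ∃ j, M.IsReduced j ∧ M.IsTrivialStage j := by
  classical
  obtain ⟨i₀, hi₀⟩ := hM.exists_nontrivial hexp hssp (by omega)
  obtain ⟨i, hi, hmin⟩ := Finset.exists_min_image
    (Finset.univ.filter fun i => M.IsReduced i ∧ ¬ M.IsTrivialStage i) id ⟨i₀, by simpa using hi₀⟩
  simp only [Finset.mem_filter, Finset.mem_univ, true_and, id] at hi hmin
  obtain ⟨hi, hnt⟩ := hi
  have htriv : ∀ j, M.IsReduced j → M.classSum (M.weight i) (some (.inr j)) ≠ 0 →
      M.IsTrivialStage j := by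
    intro j hj hne
    by_contra hc
    exact hne (hssp.classSum_weight_of_le hexp hj (hmin j ⟨hj, hc⟩))
  set κ := M.classSum (M.weight i) none with hκ
  set a := ∑ j ∈ M.reducedStages, M.classSum (M.weight i) (some (.inr j)) with ha
  set c := M.abscissa i with hc
  set d := M.d i with hd
  have hcdef : c = -d + (κ + a) := rfl
  have hsum : ∀ m : ℕ, m ≠ 0 → ∑ j ∈ M.reducedStages,
      M.classSum (M.weight i) (some (.inr j)) * M.abscissa j ^ m = 0 := fun m hm =>
    Finset.sum_eq_zero fun j hj => by
      by_cases h0 : M.classSum (M.weight i) (some (.inr j)) = 0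
      · rw [h0, zero_mul]
      · rw [(htriv j (mem_reducedStages.mp hj) h0).abscissa_eq_zero, zero_pow hm, mul_zero]
  have h1 := (hM.moment_conditions hexp hssp (m := 1) (by omega)).2 (by omega) i hi
  have h2 := (hM.moment_conditions hexp hssp (m := 2) (by omega)).2 (by omega) i hi
  rw [stageMoment, hsum _ (by norm_num), ← hκ, ← hc, ← hd] at h1 h2
  norm_num at h1 h2
  -- The weights of cubic Hermite interpolation at `c` with nodes `-1` and `0`.
  have hκc : κ = c ^ 2 * (c + 1) := by linear_combination h1 + h2
  have hac : a = c * (c + 1) ^ 2 := by linear_combination (-1) * hcdef + 2 * h1 + h2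
  -- At most one trivial stage is reduced, so the sum `a` has at most one nonzero term.
  have ha0 : a = 0 → ∀ j, M.IsReduced j → M.classSum (M.weight i) (some (.inr j)) = 0 := by
    intro h0 j hj
    by_contra hne
    rw [ha, Finset.sum_eq_single_of_mem j (mem_reducedStages.mpr hj)] at h0
    · exact hne h0
    · intro k hk hkj
      by_contra hne'
      have hk := mem_reducedStages.mp hk
      exact hkj (IsTrivialStage.unique hexp hssp hk hj (htriv k hk hne') (htriv j hj hne))
  -- At a node the interpolant is the nodal value: `c = 0` would make the stage trivial, and `c =
  -- -1` would make it `u^{n-1}`, which is not reduced.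
  have hc0 : c ≠ 0 := by
    intro h0
    have hκ0 : κ = 0 := by rw [hκc, h0]; ring
    have ha0' : a = 0 := by rw [hac, h0]; ring
    exact hnt ⟨by rw [h0, hκ0, ha0'] at hcdef; linarith, hκ0, ha0 ha0'⟩
  have hc1 : c + 1 ≠ 0 := by
    intro h0
    have hκ0 : κ = 0 := by rw [hκc, h0]; ring
    have ha0' : a = 0 := by rw [hac, h0]; ring
    have hd1 : M.d i = 1 := by rw [hκ0, ha0'] at hcdef; linarith
    refine hi.2.1 fun N F h hh ucur P u hP => ?_
    rw [hP.stage_reduced hexp hssp hh hi, hd1, ← hκ, hκ0, Finset.sum_eq_zero fun j hj => by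
      rw [ha0 ha0' j (mem_reducedStages.mp hj), zero_smul]]
    simp
  refine ⟨?_, ⟨i, hi, ?_⟩, ?_⟩
  · by_contra! hp9
    have h3 := (hM.moment_conditions hexp hssp (m := 3) (by omega)).2 (by omega) i hi
    rw [stageMoment, hsum _ (by norm_num), ← hκ, ← hc, ← hd] at h3
    norm_num at h3
    -- The left side is the Hermite interpolation error of `t^4` at `c`.
    have : (c * (c + 1)) ^ 2 = 0 := by linear_combination (-1) * h3 - h1 - 2 * h2
    exact mul_ne_zero hc0 hc1 (pow_eq_zero_iff (by norm_num) |>.mp this)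
  · rw [← hκ, hκc]
    exact mul_ne_zero (pow_ne_zero _ hc0) hc1
  · have hane : a ≠ 0 := by
      rw [hac]
      exact mul_ne_zero hc0 (pow_ne_zero _ hc1)
    obtain ⟨j, hj, hne⟩ := Finset.exists_ne_zero_of_sum_ne_zero hane
    exact ⟨j, mem_reducedStages.mp hj, htriv j (mem_reducedStages.mp hj) hne⟩

/-! ### Type II representation and stage count -/

/-- The reduced stages, numbered in increasing order. -/
noncomputable def reducedIndex (M : TSRK s) : Fin M.reducedStages.card ↪o Fin s :=
  M.reducedStages.orderEmbOfFin rfl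

theorem isReduced_reducedIndex (M : TSRK s) (k : Fin M.reducedStages.card) :
    M.IsReduced (M.reducedIndex k) :=
  mem_reducedStages.mp (Finset.orderEmbOfFin_mem _ rfl k)

theorem sum_reducedIndex {V : Type*} [AddCommMonoid V] (M : TSRK s) (f : Fin s → V) :
    ∑ k, f (M.reducedIndex k) = ∑ i ∈ M.reducedStages, f i := by
  rw [← Finset.sum_image (s := Finset.univ) (g := M.reducedIndex) (f := f)
    (M.reducedIndex.injective.injOn)]
  exact Finset.sum_congr (Finset.image_orderEmbOfFin_univ _ rfl) fun _ _ => rfl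

/-- The method with only the reduced stages; `F (u^{n-1})` is taken from stage `k₀`. -/
noncomputable def reduction (M : TSRK s) (k₀ : Fin M.reducedStages.card) :
    TSRK M.reducedStages.card where
  d k := M.d (M.reducedIndex k)
  θ := M.θ
  A := .of fun k l => M.classSum (M.weight (M.reducedIndex k)) (some (.inr (M.reducedIndex l)))
  Ahat := .of fun k l => if l = k₀ then M.classSum (M.weight (M.reducedIndex k)) none else 0
  b l := M.classSum M.outWeight (some (.inr (M.reducedIndex l)))
  bhat l := if l = k₀ then M.classSum M.outWeight none else 0

theorem IsSSP.isExplicit_reduction {M : TSRK s} (hexp : M.IsExplicit) (hssp : M.IsSSP)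
    (k₀ : Fin M.reducedStages.card) : (M.reduction k₀).IsExplicit := fun _ l hkl =>
  hssp.classSum_weight_of_le hexp (M.isReduced_reducedIndex l) (M.reducedIndex.monotone hkl)

theorem isCurrentStage_reduction {M : TSRK s} {k₀ : Fin M.reducedStages.card}
    (h : M.IsTrivialStage (M.reducedIndex k₀)) : (M.reduction k₀).IsCurrentStage k₀ := by
  refine ⟨h.1, fun l => h.2.2 _ (M.isReduced_reducedIndex l), fun l => ?_⟩
  simp [reduction, h.2.1]

theorem hasTypeIIForm_reduction {M : TSRK s} {k₀ : Fin M.reducedStages.card}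
    (h : M.IsTrivialStage (M.reducedIndex k₀)) : (M.reduction k₀).HasTypeIIForm :=
  ⟨k₀, isCurrentStage_reduction h, fun i k hk => by simp [reduction, hk],
    fun k hk => by simp [reduction, hk]⟩

/-- The only previous stage value that the reduced method uses is that of stage `k₀`, and
admissibility makes it `u^{n-1}`. -/
theorem IsSSP.equivalent_reduction {M : TSRK s} (hexp : M.IsExplicit) (hssp : M.IsSSP)
    {k₀ : Fin M.reducedStages.card} (h : M.IsTrivialStage (M.reducedIndex k₀)) :
    M.Equivalent (M.reduction k₀) := by
  intro N F h hh uprev ucur yprev y yprev' y' unext unext' hadm hadm' hst hst'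
  have hrun := M.run_points_iff.mpr ⟨hadm, hst⟩
  have hk₀ : yprev' k₀ = uprev := hadm'.1 k₀ (isCurrentStage_reduction ‹_›)
  have hy : ∀ k, y' k = y (M.reducedIndex k) := by
    intro k
    induction k using WellFoundedLT.induction with
    | ind k ih =>
      have hrhs := hrun.stage_reduced hexp hssp hh (M.isReduced_reducedIndex k)
      simp only [points] at hrhs
      rw [hst'.1 k, hrhs, ← M.sum_reducedIndex, smul_add, ← add_assoc]
      refine congrArg₂ (· + ·) ?_ (congrArg (h • ·) ?_)
      · simp [reduction, hk₀]
      · refine Finset.sum_congr rfl fun l _ => ?_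
        rcases lt_or_ge l k with hl | hl
        · rw [ih l hl]; rfl
        · have h0 := hssp.isExplicit_reduction hexp k₀ k l hl
          have h0' : M.classSum (M.weight (M.reducedIndex k))
            (some (.inr (M.reducedIndex l))) = 0 := h0
          rw [h0, h0', zero_smul, zero_smul]
  have hrhs := hrun.next_reduced hexp hssp hh
  simp only [points] at hrhs
  rw [hst'.2, hrhs, ← M.sum_reducedIndex, smul_add, ← add_assoc]
  refine congrArg₂ (· + ·) ?_ (congrArg (h • ·) ?_)
  · simp [reduction, hk₀]
  · exact Finset.sum_congr rfl fun l _ => by rw [hy l]; rfl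

theorem Equivalent.eq_of_run {V : Type*} [AddCommGroup V] [Module ℝ V] [FiniteDimensional ℝ V]
    {s' : ℕ} {M : TSRK s} {M' : TSRK s'} (hM : M.Equivalent M') {F : V → V} {h : ℝ} (hh : 0 < h)
    {ucur u u' : V} {P : Option (Fin s ⊕ Fin s) → V} {P' : Option (Fin s' ⊕ Fin s') → V}
    (hP : M.Run F h ucur P u) (hP' : M'.Run F h ucur P' u') (h0 : P none = P' none) :
    u = u' := by
  let e : V ≃ₗ[ℝ] (Fin (Module.finrank ℝ V) → ℝ) := (Module.finBasis ℝ V).equivFun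
  have h1 := hP.map e.toLinearMap (G := fun w => e (F (e.symm w))) (fun v => by simp)
  have h2 := hP'.map e.toLinearMap (G := fun w => e (F (e.symm w))) (fun v => by simp)
  rw [← points_eta (fun x => e.toLinearMap (P x)), run_points_iff] at h1
  rw [← points_eta (fun x => e.toLinearMap (P' x)), run_points_iff, ← h0] at h2
  exact e.injective (hM _ _ h hh _ _ _ _ _ _ _ _ h1.1 h2.1 h1.2 h2.2)

/-- A Type I representation needs a stage for each reduced stage and one for `u^{n-1}`. -/
theorem card_reducedStages_lt {M : TSRK s} (hexp : M.IsExplicit)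
    (hprev : M.classSum M.outWeight none ≠ 0) {s' : ℕ} {M' : TSRK s'} (hexp' : M'.IsExplicit)
    (hI : M'.HasTypeIForm) (heq : M.Equivalent M') : M.reducedStages.card < s' := by
  classical
  obtain ⟨N, F, ucur, P, u, hP, hsep⟩ := hexp.exists_separating_run one_pos
  -- The inputs from the previous step are arbitrary here, since a Type I form ignores them.
  obtain ⟨P', u', hP', hP'0, -⟩ := hexp'.exists_run F 1 (P none) ucur (fun _ => P none)
    (fun _ _ => rfl) (fun _ _ _ => rfl)
  -- An added component driven by the indicator of the point `P x` changes the output of `M` by the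
  -- weight of `x`. If `M'` never evaluates there, its output does not change.
  have key : ∀ x, M.classSum M.outWeight x ≠ 0 → ∃ j, P' (some (.inr j)) = P x := by
    intro x hx
    by_contra! hne
    let G : (Fin N → ℝ) × ℝ → ℝ := fun v => if v.1 = P x then 1 else 0
    obtain ⟨Q, r, hQ, hQ0, -⟩ := hexp.exists_extension hP G 0 0 (fun _ => 0) (fun _ _ => rfl)
      (fun _ _ _ => rfl)
    obtain ⟨Q', r', hQ', hQ'0, -⟩ := hexp'.exists_extension hP' G 0 0 (fun _ => 0)
      (fun _ _ => rfl) (fun _ _ _ => rfl)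
    have hr := congrArg Prod.snd (heq.eq_of_run one_pos hQ hQ' (by rw [hQ0, hQ'0, hP'0]))
    have h1 := congrArg Prod.snd hQ.next
    have h2 := congrArg Prod.snd hQ'.next
    simp only [Prod.snd_add, Prod.smul_snd, Prod.snd_sum, hQ0, hQ'0, smul_zero, zero_add,
      one_smul] at hr h1 h2
    rw [sum_smul_eq_classSum_smul M.outWeight x (1 : ℝ)
      (fun e he => if_pos (he.eq one_pos hP)) (fun e he => if_neg fun hc => he (hsep _ _ hc))] at h1
    rw [Finset.sum_eq_zero] at h2
    · refine hx ?_
      rw [← hr, h1, smul_eq_mul, mul_one] at h2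
      exact h2
    · rintro (j | j) _
      · rw [show M'.outWeight (.inl j) = 0 from hI.2 j, zero_smul]
      · rw [show G (P' (some (.inr j)), Q' (some (.inr j))) = 0 from if_neg (hne j), smul_zero]
  -- The reduced stages together with `u^{n-1}` are pairwise distinct points of the separating step,
  -- which gives one stage more than `M.reducedStages.card`.
  have key' : ∀ o : Finset.insertNone M.reducedStages,
      ∃ j, P' (some (.inr j)) = P (o.1.map Sum.inr) := by
    rintro ⟨_ | i, hi⟩
    · exact key none hprev
    · exact key _ (mem_reducedStages.mp (Finset.some_mem_insertNone.mp hi)).2.2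
  choose f hf using key'
  have hinj : Function.Injective f := by
    intro o o' h
    have hs := hsep _ _ (((hf o).symm.trans (congrArg _ (by rw [h]))).trans (hf o'))
    obtain ⟨_ | i, hi⟩ := o <;> obtain ⟨_ | i', hi'⟩ := o'
    · rfl
    · exact absurd hs.symm (mem_reducedStages.mp (Finset.some_mem_insertNone.mp hi')).2.1
    · exact absurd hs (mem_reducedStages.mp (Finset.some_mem_insertNone.mp hi)).2.1
    · have hi := mem_reducedStages.mp (Finset.some_mem_insertNone.mp hi)
      have hi' := mem_reducedStages.mp (Finset.some_mem_insertNone.mp hi')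
      have : i = i' := le_antisymm (hi.1 i' hs.symm) (hi'.1 i hs)
      subst this
      rfl
  have := Fintype.card_le_of_injective f hinj
  rw [Fintype.card_coe, Finset.card_insertNone, Fintype.card_fin] at this
  exact this

end TSRK

theorem theorem4 {s : ℕ} (M : TSRK s) (hexp : M.IsExplicit) (hssp : M.IsSSP)
    (p : ℕ) (hp : M.HasOrder p) :
    p ≤ 8 ∧ (6 < p → M.IsOfTypeII ∧ M.HasStageEqPrev) := by
  by_cases hp7 : 7 ≤ p
  · obtain ⟨h8, ⟨i, hi, hκ⟩, j, hj, hjt⟩ := hp.first_nontrivial hexp hssp hp7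
    refine ⟨h8, fun _ => ⟨?_, TSRK.hasStageEqPrev_of_classSum_ne_zero hexp hκ⟩⟩
    have hmem : j ∈ Set.range M.reducedIndex := by
      rw [TSRK.reducedIndex, Finset.range_orderEmbOfFin]
      exact TSRK.mem_reducedStages.mpr hj
    obtain ⟨k₀, rfl⟩ := hmem
    refine ⟨M.reducedStages.card, by simpa using Finset.card_le_univ M.reducedStages,
      ⟨M.reduction k₀, hssp.isExplicit_reduction hexp k₀, TSRK.hasTypeIIForm_reduction hjt,
        hssp.equivalent_reduction hexp hjt⟩, fun k' hk' M' hexp' hI heq => ?_⟩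
    -- A reduced stage uses `F (u^{n-1})`, so by positivity the output must use it as well.
    have hprev : M.classSum M.outWeight none ≠ 0 := fun h0 =>
      hκ (hssp.classSum_weight_eq_zero hexp hi h0)
    exact absurd hk' (not_le.mpr (TSRK.card_reducedStages_lt hexp hprev hexp' hI heq))
  · exact ⟨by omega, fun h => absurd h (by omega)⟩
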